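/- **Setting.** Let $X$ be a measurable space and $\mathcal H$ a class of measurable hypotheses $h:X\to\{0,1\}$ with VC-dimension $\mathrm{VC}(\mathcal H)\in\mathbb N\cup\{\infty\}$. Given a target $c\in\mathcal H$ and probability distributions $D^+$ on $\{c=1\}$ and $D^-$ on $\{c=0\}$, a call of the noisy oracle $\mathrm{POS}^\lambda$ (resp. $\mathrm{NEG}^\lambda$) returns, independently on each call, with probability $1-\lambda$ a point drawn from $D^+$ (resp. $D^-$), and with probability $\lambda$ an arbitrary point chosen by an adversary who knows $c$, $D^+$, $D^-$, the algorithm, the previous answers and the current contents of the algorithm's memory. An *$r$-pass online algorithm with $s$ bits of space* has a working memory with $2^s$ possible contents. In its first pass it requests $m$ labelled examples one after the other, each from the oracle of its choice; it then reads the same stream of $m$ examples again, in the same order, in $r-1$ further passes. When it reads an example it updates its memory as a function of the memory contents, the example, the pass number, the position in the stream and its random bits (which are not charged as memory). At the end it outputs a hypothesis $h\in\mathcal H$ determined by the final memory contents and the random bits. It is a *robust PAC learner with error rate $\epsilon$, failure probability $\delta$ and outlier rate $\lambda$* if, for all $c, D^+, D^-$ as above and every adversary, with probability at least $1-\delta$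 both errors $D^+(h=0)$ and $D^-(h=1)$ are less than $\epsilon$. **Theorem.** For every $\epsilon_0<\tfrac12$ there is a constant $C>0$ such that for every $\delta\in(0,1)$ there is a $d_0$ for which the following holds. Let $0<\epsilon\le\epsilon_0$, $0\le\lambda<\epsilon$, let $d\ge d_0$ be an integer with $d\le\mathrm{VC}(\mathcal H)$ (for instance $d=\mathrm{VC}(\mathcal H)$ if this is finite), and let $r\ge1$. Then every $r$-pass online robust PAC learner of $\mathcal H$ with error rate $\epsilon$, failure probability $\delta$ and outlier rate $\lambda$ (for any number $m$ of examples) uses space $$ s\;\ge\; C\,\frac{1-\epsilon}{1-\lambda}\cdot\frac dr . $$ That is, its space complexity is $\Omega\!\left(\frac{1-\epsilon}{1-\lambda}\frac dr\right)$. -/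

import Mathlib

open MeasureTheory

namespace RobustPAC

/-- The class `H` of `{0,1}`-valued hypotheses (`true` = positive) shatters the finite set `S`:
every subset of `S` is cut out of `S` by some member of `H`. -/
def Shatters {X : Type*} (H : Set (X → Bool)) (S : Finset X) : Prop :=
  ∀ T ⊆ S, ∃ h ∈ H, ∀ x ∈ S, (h x = true ↔ x ∈ T)

/-- The VC-dimension: the supremum, in `ℕ ∪ {∞}`, of the sizes of the finite shattered sets. -/
noncomputable def vcDim {X : Type*} (H : Set (X → Bool)) : ℕ∞ :=
  ⨆ (S : Finset X) (_ : Shatters H S), (S.card : ℕ∞)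

/-- The contents of a working memory of `s` bits. -/
abbrev Memory (s : ℕ) : Type := Fin s → Bool

/-- A streaming (online) learner with `s` bits of working memory for the hypothesis class `H`.
`Ω` is the set of values of its source of random bits; these bits can be read at any time and are
not charged as memory. The learner may also use the number of the current pass and the position
in the stream for free. A labelled example is a pair `(x, b)`, where `b = true` if `x` was
returned by the positive oracle and `b = false` if it was returned by the negative oracle.

* `init`: the initial contents of the memory;
* `query ω i q`: the oracle (`true` = positive, `false` = negative) from which the `i`-th example
  of the stream is requested when the memory contents are `q`;
* `step ω p i q z`: the new contents of the memory, when the example `z` is read at position `i`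
  in pass `p` and the memory contents are `q` (passes and positions are counted from `0`);
* `out`: the hypothesis of `H` that is described by the final contents of the memory. -/
structure StreamLearner {X : Type*} (Ω : Type*) (H : Set (X → Bool)) (s : ℕ) where
  init : Ω → Memory s
  query : Ω → ℕ → Memory s → Bool
  step : Ω → ℕ → ℕ → Memory s → X × Bool → Memory s
  out : Ω → Memory s → H

/-- What happens at one call of a noisy oracle, before the adversary acts: `isError` tells whether
an error occurs, `pos` and `neg` are the examples that the faithful positive and the faithful
negative oracle would return. It is given as a nested pair. -/
abbrev Draw (X : Type*) : Type _ := Bool × X × X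

/-- The record of one answered call of a noisy oracle: the returned point, the oracle that was
called, and whether the answer was an error. -/
structure Answer (X : Type*) where
  point : X
  label : Bool
  isError : Bool

/-- The labelled example that the learner sees. -/
def Answer.toExample {X : Type*} (a : Answer X) : X × Bool := (a.point, a.label)

/-- A malicious adversary: it chooses the point that is returned at an erroneous call, knowing the
whole history of previous answers, the current contents of the memory of the learner, and which
oracle is called. No assumption is made on it. -/
abbrev Adversary (X : Type*) (s : ℕ) : Type _ := List (Answer X) → Memory s → Bool → X

section Run

variable {X Ω : Type*} {H : Set (X → Bool)} {s : ℕ}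

/-- One request of an example during the first pass. The state is the contents of the memory
together with the list of the answers received so far. -/
def requestStep (A : StreamLearner Ω H s) (adv : Adversary X s) (ω : Ω)
    (st : Memory s × List (Answer X)) (ζ : Draw X) : Memory s × List (Answer X) :=
  let i := st.2.length
  let b := A.query ω i st.1
  let x := if ζ.1 then adv st.2 st.1 b else if b then ζ.2.1 else ζ.2.2
  (A.step ω 0 i st.1 (x, b), st.2 ++ [⟨x, b, ζ.1⟩])

/-- The first pass, in which the stream is obtained from the noisy oracles, one example after the
other: the memory at its end, and the list of all answers. -/
def firstPass (A : StreamLearner Ω H s) (adv : Adversary X s) (ω : Ω) (draws : List (Draw X)) :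
    Memory s × List (Answer X) :=
  draws.foldl (requestStep A adv ω) (A.init ω, [])

/-- Pass number `p` over a given stream, begun with memory contents `q`. -/
def laterPass (A : StreamLearner Ω H s) (ω : Ω) (stream : List (X × Bool)) (p : ℕ)
    (q : Memory s) : Memory s :=
  stream.zipIdx.foldl (fun q' z => A.step ω p z.2 q' z.1) q

/-- The contents of the memory after the first pass and `n` further passes over the same
stream. -/
def memoryAfter (A : StreamLearner Ω H s) (adv : Adversary X s) (ω : Ω)
    (draws : List (Draw X)) : ℕ → Memory s
  | 0 => (firstPass A adv ω draws).1
  | n + 1 => laterPass A ω ((firstPass A adv ω draws).2.map Answer.toExample) (n + 1)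
      (memoryAfter A adv ω draws n)

/-- The hypothesis that the learner outputs after `r ≥ 1` passes. -/
def output (A : StreamLearner Ω H s) (adv : Adversary X s) (ω : Ω) (draws : List (Draw X))
    (r : ℕ) : X → Bool :=
  (A.out ω (memoryAfter A adv ω draws (r - 1)) : X → Bool)

end Run

/-- The law of a coin that shows `true` with probability `lam` (for `0 ≤ lam ≤ 1`). -/
noncomputable def coin (lam : ℝ) : Measure Bool :=
  ENNReal.ofReal lam • Measure.dirac true + ENNReal.ofReal (1 - lam) • Measure.dirac false

/-- The law of `m` independent calls of the oracles with error probability `lam`, where the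
faithful examples are drawn from `Dpos` and `Dneg`. -/
noncomputable def drawLaw {X : Type*} [MeasurableSpace X] (lam : ℝ) (Dpos Dneg : Measure X)
    (m : ℕ) : Measure (Fin m → Draw X) :=
  Measure.pi fun _ => (coin lam).prod (Dpos.prod Dneg)

/-- `h` has error less than `ε` on the positive and on the negative examples. -/
def ErrorLT {X : Type*} [MeasurableSpace X] (Dpos Dneg : Measure X) (h : X → Bool) (ε : ℝ) :
    Prop :=
  Dpos {x | h x = false} < ENNReal.ofReal ε ∧ Dneg {x | h x = true} < ENNReal.ofReal ε

/-- `A`, run with `r` passes over a stream of `m` examples, is a robust PAC learner of `H` with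
error rate `ε`, failure probability `δ` and outlier rate `lam`: for every target `c ∈ H`, all
distributions `Dpos`, `Dneg` of the positive and of the negative examples of `c`, and every
adversary, the output hypothesis fails to have error less than `ε` with probability at most `δ`.
The probability is over the random bits of the learner, which have law `P`, and over the draws.
(`Measure` is an outer measure, so the inequality also makes sense if the failure event is not
measurable; then it lies in a measurable event of probability at most `δ`.) -/
def IsRobustPACLearner {X Ω : Type*} [MeasurableSpace X] [MeasurableSpace Ω] (P : Measure Ω)
    {H : Set (X → Bool)} {s : ℕ} (A : StreamLearner Ω H s) (r m : ℕ) (ε δ lam : ℝ) : Prop :=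
  ∀ c ∈ H, ∀ Dpos Dneg : Measure X, IsProbabilityMeasure Dpos → IsProbabilityMeasure Dneg →
    Dpos {x | c x = true} = 1 → Dneg {x | c x = false} = 1 →
    ∀ adv : Adversary X s,
      (P.prod (drawLaw lam Dpos Dneg m))
        {w | ¬ ErrorLT Dpos Dneg (output A adv w.1 (List.ofFn w.2) r) ε} ≤ ENNReal.ofReal δ

end RobustPAC

namespace RobustPAC

/-! ### Shattered families -/

/-! Once the random bits are fixed, the output is one of at most `2 ^ s` hypotheses, whatever the
stream, the number of passes and the adversary. Arrange about `d` shattered points in `k = d / 2`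
pairs. Each `b : Fin k → Bool` gives a target with one positive and one negative point in each pair,
with uniform distributions on the two halves. An accurate hypothesis makes at most `2 * ε₀ * k`
mistakes on these `2 * k` points, and a Chernoff bound (`card_pairMistakes_le`,
`exists_rate_lt_two`) shows that it is accurate for at most `ρ ^ k` targets, with `ρ < 2`. Averaging
over the random bits (`card_mul_le_of_measure_le`) gives `2 ^ k * (1 - δ) ≤ 2 ^ s * ρ ^ k`, so `s`
is at least linear in `d`. This is stronger than the claim, whose other factors are at most 1. -/

theorem exists_shatters_of_le_vcDim {X : Type*} {H : Set (X → Bool)} {d : ℕ} (hd : 1 ≤ d)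
    (h : (d : ℕ∞) ≤ vcDim H) : ∃ S : Finset X, Shatters H S ∧ d ≤ S.card := by
  by_contra! hcon
  have hle : vcDim H ≤ ((d - 1 : ℕ) : ℕ∞) := by
    refine iSup₂_le fun S hS => ?_
    have := hcon S hS
    exact_mod_cast (by omega : S.card ≤ d - 1)
  have := h.trans hle
  have : d ≤ d - 1 := by exact_mod_cast this
  omega

/-- A class of VC-dimension at least `d` realises all labellings of some family of `d` points. -/
theorem exists_realizes_all {X ι : Type*} [Fintype ι] {H : Set (X → Bool)} {d : ℕ} (hd : 1 ≤ d)
    (h : (d : ℕ∞) ≤ vcDim H) (hι : Fintype.card ι ≤ d) :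
    ∃ g : ι → X, ∀ f : ι → Bool, ∃ c ∈ H, ∀ p, c (g p) = f p := by
  classical
  obtain ⟨S, hS, hcard⟩ := exists_shatters_of_le_vcDim hd h
  have hcard' : Fintype.card ι ≤ Fintype.card S := by
    rw [Fintype.card_coe]
    exact hι.trans hcard
  obtain ⟨e⟩ := Function.Embedding.nonempty_of_card_le hcard'
  refine ⟨fun p => e p, fun f => ?_⟩
  obtain ⟨c, hc, hcS⟩ := hS ((Finset.univ.filter fun p => f p = true).image fun p => (e p : X))
    (by
      intro x hx
      obtain ⟨p, -, rfl⟩ := Finset.mem_image.1 hx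
      exact (e p).2)
  refine ⟨c, hc, fun p => ?_⟩
  rw [Bool.eq_iff_iff, hcS _ (e p).2]
  simp only [Finset.mem_image, Finset.mem_filter, Finset.mem_univ, true_and]
  constructor
  · rintro ⟨q, hq, hqp⟩
    rwa [← e.injective (Subtype.ext hqp)]
  · exact fun hp => ⟨p, hp, rfl⟩

/-! ### Empirical measures -/

/-- The uniform distribution on a finite family of points. -/
noncomputable def empirical {X : Type*} [MeasurableSpace X] {k : ℕ} (x : Fin k → X) : Measure X :=
  (k : ENNReal)⁻¹ • ∑ i, Measure.dirac (x i)

section Empirical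

variable {X : Type*} [MeasurableSpace X] {k : ℕ}

theorem empirical_apply (x : Fin k → X) {B : Set X} [DecidablePred (· ∈ B)]
    (hB : MeasurableSet B) :
    empirical x B = (k : ENNReal)⁻¹ * ((Finset.univ.filter fun i => x i ∈ B).card : ENNReal) := by
  simp [empirical, Measure.finsetSum_apply, Measure.dirac_apply' _ hB, Set.indicator_apply]

theorem empirical_eq_one (hk : k ≠ 0) (x : Fin k → X) {B : Set X} (hB : MeasurableSet B)
    (h : ∀ i, x i ∈ B) : empirical x B = 1 := by
  classical
  rw [empirical_apply x hB, Finset.filter_true_of_mem fun i _ => h i, Finset.card_univ,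
    Fintype.card_fin]
  exact ENNReal.inv_mul_cancel (by exact_mod_cast hk) (ENNReal.natCast_ne_top k)

theorem isProbabilityMeasure_empirical (hk : k ≠ 0) (x : Fin k → X) :
    IsProbabilityMeasure (empirical x) :=
  ⟨empirical_eq_one hk x MeasurableSet.univ fun _ => Set.mem_univ _⟩

theorem card_lt_of_empirical_lt (hk : k ≠ 0) (x : Fin k → X) {B : Set X}
    [DecidablePred (· ∈ B)] (hB : MeasurableSet B) {ε : ℝ}
    (h : empirical x B < ENNReal.ofReal ε) :
    ((Finset.univ.filter fun i => x i ∈ B).card : ℝ) < ε * k := by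
  have hk' : (0 : ℝ) < k := by exact_mod_cast Nat.pos_of_ne_zero hk
  rw [empirical_apply x hB, ← ENNReal.ofReal_natCast k, ← ENNReal.ofReal_inv_of_pos hk',
    ← ENNReal.ofReal_natCast (Finset.card _), ← ENNReal.ofReal_mul (by positivity)] at h
  have h' := (ENNReal.ofReal_lt_ofReal_iff_of_nonneg (by positivity)).1 h
  rwa [inv_mul_lt_iff₀ hk', mul_comm] at h'

end Empirical

/-! ### Counting the targets for which a hypothesis is accurate -/

/-- The number of mistakes of the predictions `f` on the pair `i`, if the point `(i, b)` of this
pair is the positive one. -/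
def pairMistakes {k : ℕ} (f : Fin k × Bool → Bool) (i : Fin k) (b : Bool) : ℕ :=
  (if f (i, b) = false then 1 else 0) + (if f (i, !b) = true then 1 else 0)

/-- Swapping the roles of the two points turns every correct prediction into a mistake, so the two
counts are 1 and 1, or 0 and 2. -/
theorem sum_pow_pairMistakes_le {k : ℕ} (f : Fin k × Bool → Bool) (i : Fin k) (t : ℝ) :
    ∑ b : Bool, t ^ pairMistakes f i b ≤ 1 + t ^ 2 := by
  have h : 2 * t ≤ 1 + t ^ 2 := by nlinarith [sq_nonneg (t - 1)]
  rw [Fintype.sum_bool]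
  cases ht : f (i, true) <;> cases hf : f (i, false) <;> simp [pairMistakes, ht, hf] <;> linarith

/-- The pairs are labelled independently, so the generating function of the number of mistakes
factors over them. -/
theorem sum_pow_sum_pairMistakes_le {k : ℕ} (f : Fin k × Bool → Bool) {t : ℝ} (ht : 0 ≤ t) :
    ∑ b : Fin k → Bool, t ^ (∑ i, pairMistakes f i (b i)) ≤ (1 + t ^ 2) ^ k := by
  have h := Fintype.prod_sum fun (i : Fin k) (b : Bool) => t ^ pairMistakes f i b
  simp_rw [← Finset.prod_pow_eq_pow_sum]
  rw [← h]
  calc ∏ i : Fin k, ∑ b : Bool, t ^ pairMistakes f i b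
      ≤ ∏ _i : Fin k, (1 + t ^ 2) := Finset.prod_le_prod
        (fun i _ => Finset.sum_nonneg fun b _ => pow_nonneg ht _)
        fun i _ => sum_pow_pairMistakes_le f i t
    _ = (1 + t ^ 2) ^ k := by simp

/-- Markov's inequality for the weight `t ^ mistakes`: as `t ≤ 1`, each counted `b` has weight at
least `t ^ (2 * ε * k)`. -/
theorem card_pairMistakes_le {k : ℕ} (f : Fin k × Bool → Bool) {t ε : ℝ} (ht : 0 < t)
    (ht1 : t ≤ 1) :
    ((Finset.univ.filter fun b : Fin k → Bool =>
      ((∑ i, pairMistakes f i (b i) : ℕ) : ℝ) ≤ 2 * ε * k).card : ℝ)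
      ≤ ((1 + t ^ 2) / t ^ (2 * ε)) ^ k := by
  have hpos : 0 < t ^ (2 * ε) := Real.rpow_pos_of_pos ht _
  rw [div_pow, le_div_iff₀ (pow_pos hpos k)]
  refine le_trans ?_ (sum_pow_sum_pairMistakes_le f ht.le)
  have hweight : ∀ n : ℕ, (n : ℝ) ≤ 2 * ε * k → (t ^ (2 * ε)) ^ k ≤ t ^ n := fun n hn => by
    rw [← Real.rpow_natCast (t ^ (2 * ε)) k, ← Real.rpow_mul ht.le, ← Real.rpow_natCast t]
    exact Real.rpow_le_rpow_of_exponent_ge ht ht1 hn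
  rw [← nsmul_eq_mul]
  refine (Finset.card_nsmul_le_sum _ (fun b => t ^ (∑ i, pairMistakes f i (b i))) _
    fun b hb => ?_).trans ?_
  · rw [Finset.mem_filter] at hb
    exact hweight (∑ i, pairMistakes f i (b i)) hb.2
  exact Finset.sum_le_sum_of_subset_of_nonneg (Finset.filter_subset _ _)
    fun b _ _ => pow_nonneg ht.le _

/-- The exponential rate in `card_pairMistakes_le` can be made smaller than `2`. -/
theorem exists_rate_lt_two {ε : ℝ} (hε : ε < 1 / 2) :
    ∃ t : ℝ, 0 < t ∧ t ≤ 1 ∧ (1 + t ^ 2) / t ^ (2 * ε) < 2 := by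
  -- This function vanishes at 1 and has positive slope there, precisely because `ε < 1 / 2`; hence
  -- it is negative just to the left of 1.
  have hder : HasDerivAt (fun t : ℝ => 1 + t ^ 2 - 2 * t ^ (2 * ε)) (2 - 4 * ε) 1 := by
    have h1 : HasDerivAt (fun t : ℝ => t ^ (2 * ε)) (2 * ε) 1 := by
      simpa using Real.hasDerivAt_rpow_const (x := 1) (p := 2 * ε) (Or.inl one_ne_zero)
    have h2 := ((hasDerivAt_pow 2 (1 : ℝ)).const_add 1).sub (h1.const_mul 2)
    refine h2.congr_deriv ?_
    norm_num
    ring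
  have hslope := (hasDerivAt_iff_tendsto_slope.1 hder).mono_left
    (nhdsWithin_mono 1 (fun t (ht : t ∈ Set.Iio (1 : ℝ)) => ne_of_lt ht))
  have hev := hslope.eventually (lt_mem_nhds (by linarith : (0 : ℝ) < 2 - 4 * ε))
  have hIoo : ∀ᶠ t : ℝ in nhdsWithin 1 (Set.Iio 1), t ∈ Set.Ioo (0 : ℝ) 1 :=
    Ioo_mem_nhdsLT one_pos
  obtain ⟨t, hs, ht0, ht1⟩ := (hev.and hIoo).exists
  refine ⟨t, ht0, ht1.le, ?_⟩
  rw [div_lt_iff₀ (Real.rpow_pos_of_pos ht0 _)]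
  rw [slope_def_field, Real.one_rpow] at hs
  by_contra! hcon
  have : (1 + t ^ 2 - 2 * t ^ (2 * ε) - (1 + 1 ^ 2 - 2 * 1)) / (t - 1) ≤ 0 :=
    div_nonpos_of_nonneg_of_nonpos (by linarith) (by linarith)
  linarith

/-! ### The lower bound on the number of memory contents -/

instance isProbabilityMeasure_drawLaw {X : Type*} [MeasurableSpace X] (Dpos Dneg : Measure X)
    [IsProbabilityMeasure Dpos] [IsProbabilityMeasure Dneg] (m : ℕ) {lam : ℝ}
    [h : Fact (lam ∈ Set.Icc (0 : ℝ) 1)] : IsProbabilityMeasure (drawLaw lam Dpos Dneg m) := by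
  have : IsProbabilityMeasure (coin lam) := ⟨by
    simp [coin, ← ENNReal.ofReal_add h.out.1 (sub_nonneg.2 h.out.2)]⟩
  unfold drawLaw
  infer_instance

/-- If every set of `F` has outer measure at most `δ`, and each point lies outside of at most `N`
of these sets, then `F` has at most `N / (1 - δ)` members. -/
theorem card_mul_le_of_measure_le {Ω ι : Type*} [Fintype ι] [MeasurableSpace Ω] (P : Measure Ω)
    [IsProbabilityMeasure P] (B : ι → Set Ω) [∀ ω, DecidablePred fun b => ω ∉ B b] {δ N : ℝ} (hδ : 0 ≤ δ)
    (hB : ∀ b, P (B b) ≤ ENNReal.ofReal δ)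
    (hN : ∀ ω, ((Finset.univ.filter fun b => ω ∉ B b).card : ℝ) ≤ N) :
    (Fintype.card ι : ℝ) * (1 - δ) ≤ N := by
  classical
  -- The sets `B b` need not be measurable; the complement of a measurable hull is a measurable part
  -- of the complement, of mass at least `1 - δ`.
  let M : ι → Set Ω := fun b => (toMeasurable P (B b))ᶜ
  have hM : ∀ b, MeasurableSet (M b) := fun b => (measurableSet_toMeasurable P (B b)).compl
  have hMP : ∀ b, 1 - δ ≤ P.real (M b) := fun b => by
    rw [measureReal_compl (measurableSet_toMeasurable P (B b)), probReal_univ]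
    have : P.real (toMeasurable P (B b)) ≤ δ :=
      ENNReal.toReal_le_of_le_ofReal hδ (by rw [measure_toMeasurable]; exact hB b)
    linarith
  have hint : ∀ b, Integrable ((M b).indicator (1 : Ω → ℝ)) P := fun b =>
    (integrable_const (1 : ℝ)).indicator (hM b)
  calc (Fintype.card ι : ℝ) * (1 - δ) = ∑ _b : ι, (1 - δ) := by
        rw [Finset.sum_const, nsmul_eq_mul, Finset.card_univ]
    _ ≤ ∑ b, P.real (M b) := Finset.sum_le_sum fun b _ => hMP b
    _ = ∑ b, ∫ ω, (M b).indicator (1 : Ω → ℝ) ω ∂P := by simp [integral_indicator_one (hM _)]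
    _ = ∫ ω, ∑ b, (M b).indicator (1 : Ω → ℝ) ω ∂P :=
      (integral_finsetSum _ fun b _ => hint b).symm
    _ ≤ ∫ _ω, N ∂P := by
      refine integral_mono (integrable_finsetSum _ fun b _ => hint b) (integrable_const N) ?_
      intro ω
      refine le_trans ?_ (hN ω)
      rw [Finset.card_filter, Nat.cast_sum]
      refine Finset.sum_le_sum fun b _ => ?_
      by_cases hω : ω ∈ M b
      · rw [Set.indicator_of_mem hω, if_pos fun h => hω (subset_toMeasurable P (B b) h)]
        simp
      · rw [Set.indicator_of_notMem hω]
        exact Nat.cast_nonneg _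
    _ = N := by simp

/-- A learner errs at least on those random bits for which no hypothesis that can be described by
the memory is accurate. -/
theorem measure_no_accurate_output_le {X Ω : Type*} [MeasurableSpace X] [MeasurableSpace Ω]
    {P : Measure Ω} [IsProbabilityMeasure P] {H : Set (X → Bool)} {s r m : ℕ}
    {A : StreamLearner Ω H s} {ε δ lam : ℝ} (hlam : lam ∈ Set.Icc (0 : ℝ) 1)
    (hA : IsRobustPACLearner P A r m ε δ lam) {c : X → Bool} (hc : c ∈ H)
    (Dpos Dneg : Measure X) [IsProbabilityMeasure Dpos] [IsProbabilityMeasure Dneg]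
    (hpos : Dpos {x | c x = true} = 1) (hneg : Dneg {x | c x = false} = 1) :
    P {ω | ∀ q, ¬ ErrorLT Dpos Dneg (A.out ω q : X → Bool) ε} ≤ ENNReal.ofReal δ := by
  have : Fact (lam ∈ Set.Icc (0 : ℝ) 1) := ⟨hlam⟩
  have : Nonempty X := nonempty_of_isProbabilityMeasure Dpos
  -- Any adversary serves here; a constant one is taken.
  refine le_trans ?_ (hA c hc Dpos Dneg inferInstance inferInstance hpos hneg
    fun _ _ _ => Classical.arbitrary X)
  -- The event does not involve the draws, so it is a cylinder in the product space.
  rw [← mul_one (P _), ← measure_univ (μ := drawLaw lam Dpos Dneg m), ← Measure.prod_prod]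
  exact measure_mono fun w hw => hw.1 _

/-- If the class realises all labellings of `k` pairs of points, then a learner needs
exponentially many memory contents. -/
theorem two_pow_mul_le_of_realizes {X Ω : Type*} [MeasurableSpace X] [MeasurableSpace Ω]
    {P : Measure Ω} [IsProbabilityMeasure P] {H : Set (X → Bool)} (hH : ∀ h ∈ H, Measurable h)
    {k s r m : ℕ} (hk : k ≠ 0) {g : Fin k × Bool → X}
    (hg : ∀ f : Fin k × Bool → Bool, ∃ c ∈ H, ∀ p, c (g p) = f p)
    {A : StreamLearner Ω H s} {ε ε₀ δ lam t : ℝ} (hlam : lam ∈ Set.Icc (0 : ℝ) 1) (hδ : 0 ≤ δ)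
    (hε : ε ≤ ε₀) (ht : 0 < t) (ht1 : t ≤ 1) (hA : IsRobustPACLearner P A r m ε δ lam) :
    (2 : ℝ) ^ k * (1 - δ) ≤ 2 ^ s * ((1 + t ^ 2) / t ^ (2 * ε₀)) ^ k := by
  classical
  let Dpos : (Fin k → Bool) → Measure X := fun b => empirical fun i => g (i, b i)
  let Dneg : (Fin k → Bool) → Measure X := fun b => empirical fun i => g (i, !b i)
  have hmeas : ∀ h ∈ H, ∀ v : Bool, MeasurableSet {x | h x = v} := fun h hh v =>
    hH h hh (measurableSet_singleton v)
  have hfail : ∀ b, P {ω | ∀ q, ¬ ErrorLT (Dpos b) (Dneg b) (A.out ω q : X → Bool) ε}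
      ≤ ENNReal.ofReal δ := fun b => by
    obtain ⟨c, hc, hcg⟩ := hg fun p => p.2 == b p.1
    have := isProbabilityMeasure_empirical hk fun i => g (i, b i)
    have := isProbabilityMeasure_empirical hk fun i => g (i, !b i)
    exact measure_no_accurate_output_le hlam hA hc (Dpos b) (Dneg b)
      (empirical_eq_one hk _ (hmeas c hc true) fun i => by simp [hcg])
      (empirical_eq_one hk _ (hmeas c hc false) fun i => by simp [hcg])
  have hgood : ∀ h ∈ H, ∀ b, ErrorLT (Dpos b) (Dneg b) h ε →
      ((∑ i, pairMistakes (fun p => h (g p)) i (b i) : ℕ) : ℝ) ≤ 2 * ε₀ * k := by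
    intro h hh b hb
    have h1 := card_lt_of_empirical_lt hk _ (hmeas h hh false) hb.1
    have h2 := card_lt_of_empirical_lt hk _ (hmeas h hh true) hb.2
    have hsum : ∑ i, pairMistakes (fun p => h (g p)) i (b i)
        = (Finset.univ.filter fun i => g (i, b i) ∈ {x | h x = false}).card
          + (Finset.univ.filter fun i => g (i, !b i) ∈ {x | h x = true}).card := by
      simp [pairMistakes, Finset.sum_add_distrib]
    rw [hsum]
    push_cast
    nlinarith [mul_le_mul_of_nonneg_right hε (Nat.cast_nonneg (α := ℝ) k)]
  have hcard := card_mul_le_of_measure_le P _ hδ hfail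
    (N := 2 ^ s * ((1 + t ^ 2) / t ^ (2 * ε₀)) ^ k) fun ω => by
      let near : Memory s → Finset (Fin k → Bool) := fun q => Finset.univ.filter fun b =>
        ((∑ i, pairMistakes (fun p => (A.out ω q : X → Bool) (g p)) i (b i) : ℕ) : ℝ)
          ≤ 2 * ε₀ * k
      -- Union bound over the memory contents: a target that does not fail at `ω` is near one of the
      -- `2 ^ s` describable hypotheses.
      have hsub : Finset.univ.filter (fun b =>
          ω ∉ {ω | ∀ q, ¬ ErrorLT (Dpos b) (Dneg b) (A.out ω q : X → Bool) ε}) ⊆ Finset.univ.biUnion near := by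
        intro b hb
        simp only [Finset.mem_filter, Finset.mem_univ, true_and, Set.mem_ofPred_eq, not_forall,
          not_not] at hb
        obtain ⟨q, hq⟩ := hb
        exact Finset.mem_biUnion.2 ⟨q, Finset.mem_univ q,
          Finset.mem_filter.2 ⟨Finset.mem_univ b, hgood _ (A.out ω q).2 b hq⟩⟩
      calc _ ≤ ((Finset.univ.biUnion near).card : ℝ) := by
            exact_mod_cast Finset.card_le_card hsub
        _ ≤ ∑ q, ((near q).card : ℝ) := by exact_mod_cast Finset.card_biUnion_le
        _ ≤ ∑ _q : Memory s, ((1 + t ^ 2) / t ^ (2 * ε₀)) ^ k :=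
            Finset.sum_le_sum fun q _ => card_pairMistakes_le _ ht ht1
        _ = _ := by simp
  simpa using hcard

end RobustPAC

/-- Space lower bound for `r`-pass online robust PAC learning. For error rates `ε` in a range
`(0, ε₀]` with `ε₀ < 1/2`, the constant `c` of the bound depends on `ε₀` only, and the bound holds
as soon as `d` exceeds a threshold that depends on `ε₀` and the failure probability `δ` only.
If `H` has finite VC-dimension, the strongest case is that where `d` is the VC-dimension; if the
VC-dimension is infinite, then the bound for all `d` says that no space suffices. -/
theorem theorem5 :
    ∀ ε₀ : ℝ, ε₀ < 1 / 2 →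
    ∃ c : ℝ, 0 < c ∧
    ∀ δ : ℝ, 0 < δ → δ < 1 →
    ∃ d₀ : ℕ,
    ∀ (ε lam : ℝ), 0 < ε → ε ≤ ε₀ → 0 ≤ lam → lam < ε →
    ∀ (X : Type*) [MeasurableSpace X] (H : Set (X → Bool)), (∀ h ∈ H, Measurable h) →
    ∀ d : ℕ, d₀ ≤ d → (d : ℕ∞) ≤ RobustPAC.vcDim H →
    ∀ (Ω : Type*) [MeasurableSpace Ω] (P : Measure Ω), IsProbabilityMeasure P →
    ∀ (r s m : ℕ), 1 ≤ r →
    ∀ A : RobustPAC.StreamLearner Ω H s,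
      RobustPAC.IsRobustPACLearner P A r m ε δ lam →
      c * ((1 - ε) / (1 - lam) * ((d : ℝ) / (r : ℝ))) ≤ (s : ℝ) := by
  intro ε₀ hε₀
  obtain ⟨t, ht, ht1, hρ⟩ := RobustPAC.exists_rate_lt_two hε₀
  set ρ : ℝ := (1 + t ^ 2) / t ^ (2 * ε₀) with hρdef
  have hρ0 : 0 < ρ := div_pos (by positivity) (Real.rpow_pos_of_pos ht _)
  have hβ : 0 < Real.log 2 - Real.log ρ := sub_pos.2 (Real.log_lt_log hρ0 hρ)
  set β : ℝ := Real.log 2 - Real.log ρ with hβdef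
  have hlog2 : 0 < Real.log 2 := Real.log_pos one_lt_two
  refine ⟨β / (8 * Real.log 2), by positivity, fun δ hδ0 hδ1 => ?_⟩
  -- For `d ≥ n` the loss `-log (1 - δ)` is at most `d * β / 8`.
  obtain ⟨n, hn⟩ := exists_nat_ge (-Real.log (1 - δ) * 8 / β)
  -- The extra 2 ensures `d / 2 ≥ 1` and `d / 2 ≥ d / 3` despite rounding.
  refine ⟨n + 2, ?_⟩
  intro ε lam hε hεε₀ hlam hlamε X _ H hH d hd hdVC Ω _ P _ r s m hr A hA
  have hk : d / 2 ≠ 0 := by omega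
  obtain ⟨g, hg⟩ := RobustPAC.exists_realizes_all (ι := Fin (d / 2) × Bool) (by omega) hdVC
    (by simp; omega)
  have hmain := RobustPAC.two_pow_mul_le_of_realizes hH hk hg ⟨hlam, by linarith⟩ hδ0.le hεε₀ ht
    ht1 hA
  rw [← hρdef] at hmain
  have hlog := Real.log_le_log (by have : 0 < 1 - δ := by linarith
                                   positivity) hmain
  rw [Real.log_mul (by positivity) (by linarith), Real.log_mul (by positivity) (by positivity),
    Real.log_pow, Real.log_pow, Real.log_pow] at hlog
  have hkd : (d : ℝ) ≤ 3 * (d / 2 : ℕ) := by exact_mod_cast (by omega : d ≤ 3 * (d / 2))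
  have hnd : (n : ℝ) ≤ d := by exact_mod_cast (by omega : n ≤ d)
  have hδd : -Real.log (1 - δ) * 8 ≤ d * β := (div_le_iff₀ hβ).1 (hn.trans hnd)
  -- The constant 8 suffices since `1/3 - 1/8 ≥ 1/8`.
  have hs : β * d ≤ s * (8 * Real.log 2) := by
    have h1 : ((d / 2 : ℕ) : ℝ) * β ≤ s * Real.log 2 - Real.log (1 - δ) := by
      rw [hβdef]
      linarith
    have h2 := mul_le_mul_of_nonneg_right hkd hβ.le
    have h3 : 0 ≤ (d : ℝ) * β := by positivity
    linarith
  have hfactor : (1 - ε) / (1 - lam) * ((d : ℝ) / r) ≤ d := by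
    have h1 : (1 - ε) / (1 - lam) ≤ 1 := (div_le_one (by linarith)).2 (by linarith)
    have h2 : (d : ℝ) / r ≤ d := div_le_self (Nat.cast_nonneg d) (by exact_mod_cast hr)
    calc _ ≤ 1 * ((d : ℝ) / r) := mul_le_mul_of_nonneg_right h1 (by positivity)
      _ ≤ d := by rwa [one_mul]
  calc _ ≤ β / (8 * Real.log 2) * d := mul_le_mul_of_nonneg_left hfactor (by positivity)
    _ ≤ s := by
      rw [div_mul_eq_mul_div]
      exact (div_le_iff₀ (by positivity)).2 hs
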